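/- Let $X,U,Y$ be complex Banach spaces, let $1\le p<\infty$, and write $\mathbb R_+=[0,\infty)$ with Lebesgue measure. Let $\mathcal U=\{U(t,\tau)\}_{t\ge\tau\ge0}$ be a strongly continuous, exponentially bounded evolution family on $X$: the $U(t,\tau)$ are bounded linear operators on $X$ with $U(t,t)=I$ and $U(t,\tau)=U(t,s)U(s,\tau)$ for $t\ge s\ge\tau\ge 0$; the map $(t,\tau)\mapsto U(t,\tau)x$ is continuous on $\{t\ge\tau\ge0\}$ for each $x\in X$; and there are $M\ge1$, $\omega\in\mathbb R$ with $\|U(t,\tau)\|\le Me^{\omega(t-\tau)}$ for all $t\ge\tau\ge0$. An evolution family is called exponentially stable if such a bound holds with some $M\ge 1$ and some $\omega<0$. For Banach spaces $E,E'$ let $L^\infty(\mathbb R_+,\mathcal L_s(E,E'))$ be the set of functions $D:\mathbb R_+\to\mathcal L(E,E')$ such that $t\mapsto D(t)x$ is strongly measurable for every $x\in E$ and $t\mapsto\|D(t)\|$ is essentially bounded. Let $B\in L^\infty(\mathbb R_+,\mathcal L_s(U,X))$ and $C\in L^\infty(\mathbb R_+,\mathcal L_s(X,Y))$, with the multiplication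 operators $(\mathcal Bu)(t)=B(t)u(t)$ and $(\mathcal Cf)(t)=C(t)f(t)$, and set $$(\mathbb Gf)(t)=\int_0^tU(t,\tau)f(\tau)\,d\tau,\qquad (\mathbb Lu)(t)=(\mathcal C\mathbb G\mathcal Bu)(t)=C(t)\int_0^tU(t,\tau)B(\tau)u(\tau)\,d\tau,\qquad t\ge0.$$ Consider the system $x(t)=U(t,s)x(s)+\int_s^tU(t,\tau)B(\tau)u(\tau)\,d\tau$, $y(t)=C(t)x(t)$, $t\ge s\ge0$. It is called stabilizable if there are $F\in L^\infty(\mathbb R_+,\mathcal L_s(X,U))$ and an exponentially stable evolution family $\{U_{BF}(t,\tau)\}_{t\ge\tau\ge0}$ on $X$ with $$U_{BF}(t,s)x=U(t,s)x+\int_s^tU(t,\tau)B(\tau)F(\tau)U_{BF}(\tau,s)x\,d\tau\qquad(t\ge s\ge0,\ x\in X),$$ and detectable if there are $K\in L^\infty(\mathbb R_+,\mathcal L_s(Y,X))$ and an exponentially stable evolution family $\{U_{KC}(t,\tau)\}_{t\ge\tau\ge0}$ on $X$ with $$U_{KC}(t,s)x=U(t,s)x+\int_s^tU_{KC}(t,\tau)K(\tau)C(\tau)U(\tau,s)x\,d\tau\qquad(t\ge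 s\ge0,\ x\in X).$$ Then the following are equivalent: (i) $\mathcal U$ is exponentially stable; (ii) $\mathbb G$ is a bounded operator on $L^p(\mathbb R_+,X)$; (iii) the system is stabilizable and $\mathbb G\mathcal B$ is a bounded operator from $L^p(\mathbb R_+,U)$ to $L^p(\mathbb R_+,X)$; (iv) the system is detectable and $\mathcal C\mathbb G$ is a bounded operator from $L^p(\mathbb R_+,X)$ to $L^p(\mathbb R_+,Y)$; (v) the system is stabilizable, detectable and input–output stable, i.e. $\mathbb L=\mathcal C\mathbb G\mathcal B$ is a bounded operator from $L^p(\mathbb R_+,U)$ to $L^p(\mathbb R_+,Y)$. In particular, the system is internally stable (i.e. $\mathcal U$ is exponentially stable) if and only if it is stabilizable, detectable and input–output stable. -/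

import Mathlib

open MeasureTheory Set
open scoped ENNReal NNReal

noncomputable section

namespace EvolutionSystem

/-- Lebesgue measure on the half-line `[0, ∞)`, so that `L^p(ℝ₊, E)` is `L^p` of this measure. -/
def halfLine : Measure ℝ := volume.restrict (Ici 0)

section Defs

variable {E E' X U Y : Type*}
  [NormedAddCommGroup E] [NormedSpace ℂ E] [NormedAddCommGroup E'] [NormedSpace ℂ E']
  [NormedAddCommGroup X] [NormedSpace ℂ X]
  [NormedAddCommGroup U] [NormedSpace ℂ U]
  [NormedAddCommGroup Y] [NormedSpace ℂ Y]

/-- A (strongly continuous) evolution family on `X` over the half-line: bounded operators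
`𝒰 t τ`, of which only the values with `t ≥ τ ≥ 0` matter. -/
structure IsEvolutionFamily (𝒰 : ℝ → ℝ → X →L[ℂ] X) : Prop where
  comp : ∀ t s τ, 0 ≤ τ → τ ≤ s → s ≤ t → 𝒰 t τ = (𝒰 t s).comp (𝒰 s τ)
  refl : ∀ t, 0 ≤ t → 𝒰 t t = ContinuousLinearMap.id ℂ X
  continuousOn : ∀ x : X,
    ContinuousOn (fun q : ℝ × ℝ => 𝒰 q.1 q.2 x) {q : ℝ × ℝ | 0 ≤ q.2 ∧ q.2 ≤ q.1}

/-- `‖𝒰(t, τ)‖ ≤ M e^{ω (t - τ)}` for all `t ≥ τ ≥ 0`. -/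
def ExpBoundWith (𝒰 : ℝ → ℝ → X →L[ℂ] X) (M ω : ℝ) : Prop :=
  ∀ t τ, 0 ≤ τ → τ ≤ t → ‖𝒰 t τ‖ ≤ M * Real.exp (ω * (t - τ))

/-- Exponential boundedness. -/
def IsExpBounded (𝒰 : ℝ → ℝ → X →L[ℂ] X) : Prop :=
  ∃ M ω : ℝ, 1 ≤ M ∧ ExpBoundWith 𝒰 M ω

/-- (Uniform) exponential stability: the exponent can be taken strictly negative. -/
def IsExpStable (𝒰 : ℝ → ℝ → X →L[ℂ] X) : Prop :=
  ∃ M ω : ℝ, 1 ≤ M ∧ ω < 0 ∧ ExpBoundWith 𝒰 M ω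

/-- `D ∈ L^∞(ℝ₊, 𝓛_s(E, E'))`: `t ↦ D(t) x` is strongly (Bochner) measurable on `ℝ₊` for every
`x`, and `t ↦ ‖D(t)‖` is essentially bounded on `ℝ₊`. -/
structure IsLinftyStrong (D : ℝ → E →L[ℂ] E') : Prop where
  aestronglyMeasurable : ∀ x : E, AEStronglyMeasurable (fun t => D t x) halfLine
  essBounded : ∃ M : ℝ, ∀ᵐ t ∂halfLine, ‖D t‖ ≤ M

/-- The multiplication operator `(𝓓 f)(t) = D(t) f(t)`. -/
def mulOp (D : ℝ → E →L[ℂ] E') (f : ℝ → E) : ℝ → E' := fun t => D t (f t)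

/-- The operator `(𝔾 f)(t) = ∫₀ᵗ 𝒰(t, τ) f(τ) dτ`. -/
def GOp (𝒰 : ℝ → ℝ → X →L[ℂ] X) (f : ℝ → X) : ℝ → X :=
  fun t => ∫ τ in (0 : ℝ)..t, 𝒰 t τ (f τ)

/-- The input-output operator `𝕃 = 𝓒 𝔾 𝓑`, `(𝕃 u)(t) = C(t) ∫₀ᵗ 𝒰(t, τ) B(τ) u(τ) dτ`. -/
def ioOp (𝒰 : ℝ → ℝ → X →L[ℂ] X) (B : ℝ → U →L[ℂ] X) (C : ℝ → X →L[ℂ] Y) (u : ℝ → U) : ℝ → Y :=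
  mulOp C (GOp 𝒰 (mulOp B u))

/-- A (pointwise defined, linear) operator `T` is a bounded operator from `L^p(ℝ₊, E)` to
`L^p(ℝ₊, E')`: it maps `L^p` into `L^p`, with a uniform bound on the norms. -/
def IsBoundedLp (p : ℝ≥0∞) (T : (ℝ → E) → (ℝ → E')) : Prop :=
  ∃ K : ℝ≥0, ∀ f : ℝ → E, MemLp f p halfLine →
    MemLp (T f) p halfLine ∧ eLpNorm (T f) p halfLine ≤ K * eLpNorm f p halfLine

/-- Stabilizability: some `F ∈ L^∞(ℝ₊, 𝓛_s(X, U))` and exponentially stable evolution family `V`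
satisfy `V(t,s)x = 𝒰(t,s)x + ∫ₛᵗ 𝒰(t,τ) B(τ) F(τ) V(τ,s)x dτ`. -/
def IsStabilizable (𝒰 : ℝ → ℝ → X →L[ℂ] X) (B : ℝ → U →L[ℂ] X) : Prop :=
  ∃ (F : ℝ → X →L[ℂ] U) (V : ℝ → ℝ → X →L[ℂ] X),
    IsLinftyStrong F ∧ IsEvolutionFamily V ∧ IsExpStable V ∧
    ∀ t s, 0 ≤ s → s ≤ t → ∀ x : X,
      V t s x = 𝒰 t s x + ∫ τ in s..t, 𝒰 t τ (B τ (F τ (V τ s x)))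

/-- Detectability: some `K ∈ L^∞(ℝ₊, 𝓛_s(Y, X))` and exponentially stable evolution family `V`
satisfy `V(t,s)x = 𝒰(t,s)x + ∫ₛᵗ V(t,τ) K(τ) C(τ) 𝒰(τ,s)x dτ`. -/
def IsDetectable (𝒰 : ℝ → ℝ → X →L[ℂ] X) (C : ℝ → X →L[ℂ] Y) : Prop :=
  ∃ (K : ℝ → Y →L[ℂ] X) (V : ℝ → ℝ → X →L[ℂ] X),
    IsLinftyStrong K ∧ IsEvolutionFamily V ∧ IsExpStable V ∧
    ∀ t s, 0 ≤ s → s ≤ t → ∀ x : X,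
      V t s x = 𝒰 t s x + ∫ τ in s..t, V t τ (K τ (C τ (𝒰 τ s x)))

end Defs

end EvolutionSystem

end

/-!
The implications out of exponential stability are Young's inequality: the kernel of `𝔾` is
dominated by the convolution kernel `M e^{ω t}`, `t ≥ 0`, which is integrable for `ω < 0`
(`isBoundedLp_GOp_of_isExpStable`). Multiplication operators are bounded on `L^p`, and the zero
feedback shows that a stable system is stabilizable and detectable.

The converse from boundedness of `𝔾` is Datko's theorem (`isExpStable_of_isBoundedLp_GOp`).
Applying `𝔾` to `1_{(s, s+1]} 𝒰(·, s) x` returns the orbit `𝒰(t, s) x` for `t ≥ s + 1`, so all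
orbits are in `L^p` with norm at most a constant times `‖x‖`. Because `p < ∞`, such a bound forces
`𝒰` to be uniformly bounded and then to contract over a long enough time span.

Stabilizability and detectability enter through operator identities. By Fubini's theorem a
perturbation formula `W(t,s) = V(t,s) + ∫ₛᵗ P(t,τ) D(τ) Q(τ,s) dτ` integrates to
`𝔾_W = 𝔾_V + 𝔾_P 𝓓 𝔾_Q` (`GOp_sub_GOp_eq`). For the closed-loop family this reads
`𝔾 = 𝔾_F - (𝔾 𝓑) 𝓕 𝔾_F`, and for the observer family `𝔾 = 𝔾_K - 𝔾_K 𝓚 (𝓒 𝔾)`, where `𝔾_F` and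
`𝔾_K` are bounded by the first step. The second identity passes from `𝓒 𝔾` to `𝔾`; the first one,
multiplied by `𝓒` from the left, passes from `𝓒 𝔾 𝓑` to `𝓒 𝔾`, and with the identity in place of
`𝓒` from `𝔾 𝓑` to `𝔾`.
-/

open MeasureTheory Set
open scoped ENNReal NNReal

noncomputable section
namespace EvolutionSystem
variable {E E' E'' X U Y : Type*}
  [NormedAddCommGroup E] [NormedSpace ℂ E] [NormedAddCommGroup E'] [NormedSpace ℂ E']
  [NormedAddCommGroup E''] [NormedSpace ℂ E'']
  [NormedAddCommGroup X] [NormedSpace ℂ X]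
  [NormedAddCommGroup U] [NormedSpace ℂ U]
  [NormedAddCommGroup Y] [NormedSpace ℂ Y]

/-! ### Strongly measurable operator functions -/

/-- A strongly measurable operator-valued function applied to a strongly measurable function is
strongly measurable: this is clear for simple functions, and the general case is a limit. -/
theorem aestronglyMeasurable_clm_apply {α : Type*} [MeasurableSpace α] {μ : Measure α}
    {D : α → E →L[ℂ] E'} (hD : ∀ x : E, AEStronglyMeasurable (fun a => D a x) μ)
    {f : α → E} (hf : AEStronglyMeasurable f μ) :
    AEStronglyMeasurable (fun a => D a (f a)) μ := by
  have hsimple : ∀ s : SimpleFunc α E, AEStronglyMeasurable (fun a => D a (s a)) μ := by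
    intro s
    have hsum : (fun a => D a (s a)) =
        fun a => ∑ y ∈ s.range, (s ⁻¹' {y}).indicator (fun a => D a y) a := by
      funext a
      rw [Finset.sum_eq_single (s a)]
      · simp
      · intro y _ hy
        exact indicator_of_notMem (fun h => hy (by simpa using h.symm)) _
      · intro h
        exact absurd (s.mem_range_self a) h
    rw [hsum]
    exact Finset.aestronglyMeasurable_fun_sum _
      (fun y _ => (hD y).indicator (s.measurableSet_preimage _))
  refine aestronglyMeasurable_of_tendsto_ae Filter.atTop
    (f := fun n a => D a (hf.stronglyMeasurable_mk.approx n a)) (fun n => hsimple _) ?_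
  filter_upwards [hf.ae_eq_mk] with a ha
  rw [ha]
  exact ((D a).continuous.tendsto _).comp (hf.stronglyMeasurable_mk.tendsto_approx a)

theorem IsLinftyStrong.exists_nnnorm_le {D : ℝ → E →L[ℂ] E'} (hD : IsLinftyStrong D) :
    ∃ K : ℝ≥0, ∀ᵐ t ∂halfLine, ‖D t‖ ≤ K := by
  obtain ⟨M, hM⟩ := hD.essBounded
  exact ⟨M.toNNReal, hM.mono fun t ht => ht.trans (Real.le_coe_toNNReal M)⟩

theorem IsLinftyStrong.comp {D : ℝ → E →L[ℂ] E'} {D' : ℝ → E' →L[ℂ] E''}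
    (hD' : IsLinftyStrong D') (hD : IsLinftyStrong D) :
    IsLinftyStrong (fun t => (D' t).comp (D t)) where
  aestronglyMeasurable x :=
    aestronglyMeasurable_clm_apply hD'.aestronglyMeasurable (hD.aestronglyMeasurable x)
  essBounded := by
    obtain ⟨K, hK⟩ := hD.exists_nnnorm_le
    obtain ⟨K', hK'⟩ := hD'.exists_nnnorm_le
    refine ⟨K' * K, ?_⟩
    filter_upwards [hK, hK'] with t h h'
    exact ((D' t).opNorm_comp_le (D t)).trans (by gcongr)

theorem isLinftyStrong_zero : IsLinftyStrong (fun _ : ℝ => (0 : E →L[ℂ] E')) where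
  aestronglyMeasurable x := by simpa using aestronglyMeasurable_const
  essBounded := ⟨0, by simp⟩

theorem isLinftyStrong_id : IsLinftyStrong (fun _ : ℝ => ContinuousLinearMap.id ℂ X) where
  aestronglyMeasurable x := by simpa using aestronglyMeasurable_const
  essBounded := ⟨1, Filter.Eventually.of_forall fun _ => ContinuousLinearMap.norm_id_le⟩

/-! ### Bounded operators between `L^p` spaces of the half-line -/

omit [NormedSpace ℂ E] [NormedSpace ℂ E'] [NormedSpace ℂ E''] in
theorem IsBoundedLp.comp {p : ℝ≥0∞} {S : (ℝ → E') → ℝ → E''} {T : (ℝ → E) → ℝ → E'}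
    (hS : IsBoundedLp p S) (hT : IsBoundedLp p T) : IsBoundedLp p (fun f => S (T f)) := by
  obtain ⟨K, hK⟩ := hS
  obtain ⟨K', hK'⟩ := hT
  refine ⟨K * K', fun f hf => ⟨(hK _ (hK' f hf).1).1, (hK _ (hK' f hf).1).2.trans ?_⟩⟩
  rw [ENNReal.coe_mul, mul_assoc]
  gcongr
  exact (hK' f hf).2

omit [NormedSpace ℂ E] [NormedSpace ℂ E'] in
theorem IsBoundedLp.sub {p : ℝ≥0∞} (hp : 1 ≤ p) {S T : (ℝ → E) → ℝ → E'}
    (hS : IsBoundedLp p S) (hT : IsBoundedLp p T) : IsBoundedLp p (fun f => S f - T f) := by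
  obtain ⟨K, hK⟩ := hS
  obtain ⟨K', hK'⟩ := hT
  refine ⟨K + K', fun f hf => ⟨(hK f hf).1.sub (hK' f hf).1, ?_⟩⟩
  refine (eLpNorm_sub_le (hK f hf).1.1 (hK' f hf).1.1 hp).trans ?_
  rw [ENNReal.coe_add, add_mul]
  exact add_le_add (hK f hf).2 (hK' f hf).2

omit [NormedSpace ℂ E] [NormedSpace ℂ E'] in
theorem IsBoundedLp.congr {p : ℝ≥0∞} {S T : (ℝ → E) → ℝ → E'} (hS : IsBoundedLp p S)
    (h : ∀ f, MemLp f p halfLine → ∀ t, 0 ≤ t → T f t = S f t) : IsBoundedLp p T := by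
  obtain ⟨K, hK⟩ := hS
  refine ⟨K, fun f hf => ?_⟩
  have hae : T f =ᵐ[halfLine] S f :=
    (ae_restrict_mem measurableSet_Ici).mono fun t ht => h f hf t ht
  exact ⟨(hK f hf).1.ae_eq hae.symm, (eLpNorm_congr_ae hae).trans_le (hK f hf).2⟩

theorem isBoundedLp_mulOp (p : ℝ≥0∞) {D : ℝ → E →L[ℂ] E'} (hD : IsLinftyStrong D) :
    IsBoundedLp p (mulOp D) := by
  obtain ⟨K, hK⟩ := hD.exists_nnnorm_le
  have hle : ∀ f : ℝ → E, ∀ᵐ t ∂halfLine, ‖mulOp D f t‖₊ ≤ K * ‖f t‖₊ := fun f =>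
    hK.mono fun t ht => (D t).le_of_opNorm_le ht (f t)
  have hle' := fun f => eLpNorm_le_nnreal_smul_eLpNorm_of_ae_le_mul (hle f) p
  refine ⟨K, fun f hf => ⟨⟨aestronglyMeasurable_clm_apply hD.aestronglyMeasurable hf.1, ?_⟩,
    hle' f⟩⟩
  exact (hle' f).trans_lt (ENNReal.mul_lt_top ENNReal.coe_lt_top hf.2)

/-! ### Regularity of the integral kernel -/

omit [NormedSpace ℂ E] in
theorem integrableOn_Ioc_of_memLp {p : ℝ≥0∞} (hp : 1 ≤ p) {f : ℝ → E} (hf : MemLp f p halfLine)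
    {a : ℝ} (ha : 0 ≤ a) (b : ℝ) : IntegrableOn f (Ioc a b) := by
  have hsub : Ioc a b ⊆ Ici 0 := fun x hx => ha.trans hx.1.le
  have : MemLp f p (volume.restrict (Ioc a b)) :=
    hf.mono_measure (Measure.restrict_mono_set _ hsub)
  exact this.integrable hp

/-- The triangle on which the kernel of `𝔾` lives. The diagonal edge is included and the edge
`τ = 0` is not, so that the section at time `t ≥ 0` is the interval `Ioc 0 t`. -/
def triangle : Set (ℝ × ℝ) := {q | 0 < q.2 ∧ q.2 ≤ q.1}

theorem measurableSet_triangle : MeasurableSet triangle :=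
  (measurableSet_lt measurable_const measurable_snd).inter
    (measurableSet_le measurable_snd measurable_fst)

theorem IsEvolutionFamily.aestronglyMeasurable_kernel {V : ℝ → ℝ → X →L[ℂ] X}
    (hV : IsEvolutionFamily V) {f : ℝ → X} (hf : AEStronglyMeasurable f halfLine) :
    AEStronglyMeasurable (fun q : ℝ × ℝ => V q.1 q.2 (f q.2)) (volume.restrict triangle) := by
  refine aestronglyMeasurable_clm_apply (D := fun q : ℝ × ℝ => V q.1 q.2) (fun x => ?_) ?_
  · exact ((hV.continuousOn x).mono fun q hq => ⟨hq.1.le, hq.2⟩).aestronglyMeasurable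
      measurableSet_triangle
  · have h : AEStronglyMeasurable (fun q : ℝ × ℝ => f q.2)
        ((volume : Measure ℝ).prod halfLine) := hf.comp_snd
    have heq : (volume : Measure ℝ).prod halfLine =
        (volume : Measure (ℝ × ℝ)).restrict (univ ×ˢ Ici 0) := by
      rw [Measure.volume_eq_prod, ← Measure.prod_restrict, Measure.restrict_univ, halfLine]
    rw [heq] at h
    exact h.mono_measure (Measure.restrict_mono_set _ fun q hq => ⟨mem_univ _, hq.1.le⟩)

theorem GOp_eq_integral_indicator (V : ℝ → ℝ → X →L[ℂ] X) (f : ℝ → X) {t : ℝ} (ht : 0 ≤ t) :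
    GOp V f t = ∫ τ, triangle.indicator (fun q : ℝ × ℝ => V q.1 q.2 (f q.2)) (t, τ) := by
  rw [GOp, intervalIntegral.integral_of_le ht, ← integral_indicator measurableSet_Ioc]
  rfl

theorem IsEvolutionFamily.aestronglyMeasurable_GOp {V : ℝ → ℝ → X →L[ℂ] X}
    (hV : IsEvolutionFamily V) {f : ℝ → X} (hf : AEStronglyMeasurable f halfLine) :
    AEStronglyMeasurable (GOp V f) halfLine := by
  have h := (aestronglyMeasurable_indicator_iff measurableSet_triangle).2
    (hV.aestronglyMeasurable_kernel hf)
  rw [Measure.volume_eq_prod] at h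
  refine (h.integral_prod_right'.mono_measure Measure.restrict_le_self).congr ?_
  filter_upwards [ae_restrict_mem measurableSet_Ici] with t ht
  exact (GOp_eq_integral_indicator V f ht).symm

/-! ### Exponential stability makes `𝔾` bounded -/

/-- Young's inequality for the convolution with an integrable kernel, in `L^r`, `1 ≤ r < ∞`.
Hölder's inequality is applied to `k g = k^{1 - 1/r} (k g^r)^{1/r}`. -/
theorem lintegral_convolution_rpow_le {k g : ℝ → ℝ≥0∞} (hk : Measurable k)
    (hg : AEMeasurable g) {r : ℝ} (hr : 1 ≤ r) (hk' : ∫⁻ t, k t ≠ ∞) :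
    ∫⁻ t, (∫⁻ τ, k (t - τ) * g τ) ^ r ≤ (∫⁻ t, k t) ^ r * ∫⁻ τ, g τ ^ r := by
  have hr0 : 0 < r := one_pos.trans_le hr
  have hrinv : r⁻¹ ≤ 1 := inv_le_one_of_one_le₀ hr
  set κ := ∫⁻ t, k t
  have hfin : ∀ t, ∀ᵐ τ, k (t - τ) ≠ ∞ := by
    intro t
    have : ∫⁻ τ, k (t - τ) ≠ ∞ := by rwa [lintegral_sub_left_eq_self k t]
    exact (ae_lt_top (hk.comp (measurable_const.sub measurable_id)) this).mono fun _ h => h.ne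
  have hholder : ∀ t, (∫⁻ τ, k (t - τ) * g τ) ^ r ≤
      κ ^ (r - 1) * ∫⁻ τ, k (t - τ) * g τ ^ r := by
    intro t
    have hkt : AEMeasurable (fun τ => k (t - τ)) :=
      (hk.comp (measurable_const.sub measurable_id)).aemeasurable
    have h := ENNReal.lintegral_mul_norm_pow_le (μ := volume) hkt
      (hkt.mul (hg.pow_const r)) (p := 1 - r⁻¹) (q := r⁻¹) (by linarith) (by positivity) (by ring)
    rw [lintegral_sub_left_eq_self k t] at h
    have hpt : ∫⁻ τ, k (t - τ) * g τ =
        ∫⁻ τ, k (t - τ) ^ (1 - r⁻¹) * (k (t - τ) * g τ ^ r) ^ r⁻¹ := by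
      refine lintegral_congr_ae ((hfin t).mono fun τ hτ => ?_)
      simp only
      rw [ENNReal.mul_rpow_of_nonneg _ _ (by positivity), ← mul_assoc,
        ← ENNReal.rpow_add_of_nonneg _ _ (by linarith) (by positivity), ENNReal.rpow_rpow_inv hr0.ne']
      simp
    rw [hpt]
    refine (ENNReal.rpow_le_rpow h hr0.le).trans_eq ?_
    rw [ENNReal.mul_rpow_of_nonneg _ _ hr0.le, ← ENNReal.rpow_mul, ENNReal.rpow_inv_rpow hr0.ne']
    congr 2
    field_simp
  calc ∫⁻ t, (∫⁻ τ, k (t - τ) * g τ) ^ r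
      ≤ ∫⁻ t, κ ^ (r - 1) * ∫⁻ τ, k (t - τ) * g τ ^ r := lintegral_mono hholder
    _ = κ ^ (r - 1) * ∫⁻ t, ∫⁻ τ, k (t - τ) * g τ ^ r :=
        lintegral_const_mul' _ _ (ENNReal.rpow_ne_top_of_nonneg (by linarith) hk')
    _ = κ ^ (r - 1) * ∫⁻ τ, ∫⁻ t, k (t - τ) * g τ ^ r := by
        rw [lintegral_lintegral_swap]
        exact ((hk.comp (measurable_fst.sub measurable_snd)).aemeasurable).mul
          (hg.comp_snd.pow_const r)
    _ = κ ^ (r - 1) * ∫⁻ τ, κ * g τ ^ r := by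
        congr 1
        refine lintegral_congr fun τ => ?_
        have hkτ : Measurable fun t => k (t - τ) := hk.comp (measurable_id.sub measurable_const)
        rw [lintegral_mul_const _ hkτ, lintegral_sub_right_eq_self k τ]
    _ = κ ^ r * ∫⁻ τ, g τ ^ r := by
        rw [lintegral_const_mul' _ _ hk', ← mul_assoc]
        congr 1
        conv_lhs => rw [← ENNReal.rpow_one κ, ← ENNReal.rpow_mul, one_mul]
        rw [← ENNReal.rpow_add_of_nonneg _ _ (by linarith) zero_le_one, sub_add_cancel]

/-- The kernel of `𝔾` is dominated by an integrable convolution kernel, so Young's inequality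
applies. -/
theorem isBoundedLp_GOp_of_isExpStable {p : ℝ≥0∞} (hp : 1 ≤ p) (hp' : p ≠ ∞)
    {V : ℝ → ℝ → X →L[ℂ] X} (hV : IsEvolutionFamily V) (hs : IsExpStable V) :
    IsBoundedLp p (GOp V) := by
  obtain ⟨M, ω, hM, hω, hb⟩ := hs
  have hp0 : p ≠ 0 := (one_pos.trans_le hp).ne'
  have hr : 1 ≤ p.toReal := by
    simpa using ENNReal.toReal_mono hp' hp
  have hr0 : 0 < p.toReal := one_pos.trans_le hr
  set k : ℝ → ℝ≥0∞ := (Ici (0 : ℝ)).indicator fun t => ENNReal.ofReal (M * Real.exp (ω * t))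
    with hk
  have hkm : Measurable k := Measurable.indicator (by fun_prop) measurableSet_Ici
  have hint : ∫⁻ t, k t ≠ ∞ := by
    rw [hk, lintegral_indicator measurableSet_Ici, setLIntegral_congr Ioi_ae_eq_Ici.symm]
    have hi : IntegrableOn (fun t => M * Real.exp (ω * t)) (Ioi 0) :=
      (integrableOn_exp_mul_Ioi hω 0).const_mul M
    exact hi.lintegral_lt_top.ne
  have hle : ∀ f : ℝ → X, MemLp f p halfLine →
      eLpNorm (GOp V f) p halfLine ≤ (∫⁻ t, k t) * eLpNorm f p halfLine := by
    intro f hf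
    set g : ℝ → ℝ≥0∞ := (Ici (0 : ℝ)).indicator fun τ => ‖f τ‖ₑ with hg
    have hgm : AEMeasurable g := (aemeasurable_indicator_iff measurableSet_Ici).2 hf.1.enorm
    have hpt : ∀ t ∈ Ici (0 : ℝ), ‖GOp V f t‖ₑ ≤ ∫⁻ τ, k (t - τ) * g τ := by
      intro t ht
      rw [GOp_eq_integral_indicator V f ht]
      refine (enorm_integral_le_lintegral_enorm _).trans (lintegral_mono fun τ => ?_)
      by_cases hτ : (t, τ) ∈ triangle
      · have h0 : 0 ≤ τ := hτ.1.le
        have h1 : τ ≤ t := hτ.2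
        rw [indicator_of_mem hτ, hk, hg, indicator_of_mem (by simpa using h1),
          indicator_of_mem (by simpa using h0)]
        rw [← ofReal_norm, ← ofReal_norm, ← ENNReal.ofReal_mul (by positivity)]
        exact ENNReal.ofReal_le_ofReal ((V t τ).le_of_opNorm_le (hb t τ h0 h1) _)
      · rw [indicator_of_notMem hτ]
        simp
    rw [eLpNorm_eq_lintegral_rpow_enorm_toReal hp0 hp',
      eLpNorm_eq_lintegral_rpow_enorm_toReal hp0 hp']
    have hgint : ∫⁻ τ, g τ ^ p.toReal = ∫⁻ τ, ‖f τ‖ₑ ^ p.toReal ∂halfLine := by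
      rw [halfLine, ← lintegral_indicator measurableSet_Ici]
      refine lintegral_congr fun τ => ?_
      by_cases hτ : τ ∈ Ici (0 : ℝ) <;> simp [hg, hτ, hr0]
    have hmain : ∫⁻ t, ‖GOp V f t‖ₑ ^ p.toReal ∂halfLine ≤
        (∫⁻ t, k t) ^ p.toReal * ∫⁻ τ, ‖f τ‖ₑ ^ p.toReal ∂halfLine := by
      rw [← hgint]
      refine le_trans ?_ (lintegral_convolution_rpow_le hkm hgm hr hint)
      refine le_trans (setLIntegral_mono_ae' measurableSet_Ici
        (Filter.Eventually.of_forall fun t ht => ?_)) (setLIntegral_le_lintegral (Ici 0) _)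
      exact ENNReal.rpow_le_rpow (hpt t ht) hr0.le
    refine (ENNReal.rpow_le_rpow hmain (by positivity)).trans_eq ?_
    rw [ENNReal.mul_rpow_of_nonneg _ _ (by positivity), one_div, ENNReal.rpow_rpow_inv hr0.ne']
  refine ⟨(∫⁻ t, k t).toNNReal, fun f hf => ?_⟩
  rw [ENNReal.coe_toNNReal hint]
  exact ⟨⟨hV.aestronglyMeasurable_GOp hf.1,
    (hle f hf).trans_lt (ENNReal.mul_lt_top hint.lt_top hf.2)⟩, hle f hf⟩

/-! ### Perturbation formulas and the operators `𝔾` -/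

theorem ExpBoundWith.norm_le {V : ℝ → ℝ → X →L[ℂ] X} {M ω : ℝ} (hM : 1 ≤ M)
    (hV : ExpBoundWith V M ω) {t τ T : ℝ} (hτ : 0 ≤ τ) (hτt : τ ≤ t) (hT : t - τ ≤ T) :
    ‖V t τ‖ ≤ M * Real.exp (|ω| * T) := by
  refine (hV t τ hτ hτt).trans ?_
  have h0 : 0 ≤ t - τ := sub_nonneg.2 hτt
  gcongr
  exact le_abs_self ω

theorem IsEvolutionFamily.integrableOn_kernel {V : ℝ → ℝ → X →L[ℂ] X} (hV : IsEvolutionFamily V)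
    (hVb : IsExpBounded V) {p : ℝ≥0∞} (hp : 1 ≤ p) {f : ℝ → X} (hf : MemLp f p halfLine) (t : ℝ) :
    IntegrableOn (fun τ => V t τ (f τ)) (Ioc 0 t) := by
  obtain ⟨M, ω, hM, hb⟩ := hVb
  have hfi := integrableOn_Ioc_of_memLp hp hf le_rfl t
  refine (hfi.norm.const_mul (M * Real.exp (|ω| * t))).mono' ?_ ?_
  · refine aestronglyMeasurable_clm_apply (fun x => ?_) hfi.1
    have hc : ContinuousOn (fun τ => V t τ x) (Ioc 0 t) :=
      (hV.continuousOn x).comp (f := fun τ => (t, τ)) (by fun_prop) fun τ hτ => ⟨hτ.1.le, hτ.2⟩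
    exact hc.aestronglyMeasurable measurableSet_Ioc
  · filter_upwards [ae_restrict_mem measurableSet_Ioc] with τ hτ
    exact (V t τ).le_of_opNorm_le
      (hb.norm_le hM hτ.1.le hτ.2 (by linarith [hτ.1])) _

/-- Fubini's theorem on the triangle `0 < s < τ ≤ t` for the integral term of a perturbation
formula. -/
theorem integral_perturbation_eq [CompleteSpace X] {P Q : ℝ → ℝ → X →L[ℂ] X}
    (hP : IsEvolutionFamily P) (hPb : IsExpBounded P)
    (hQ : IsEvolutionFamily Q) (hQb : IsExpBounded Q)
    {D : ℝ → X →L[ℂ] X} (hD : IsLinftyStrong D)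
    {p : ℝ≥0∞} (hp : 1 ≤ p) {f : ℝ → X} (hf : MemLp f p halfLine) {t : ℝ} (ht : 0 ≤ t) :
    ∫ s in (0 : ℝ)..t, ∫ τ in s..t, P t τ (D τ (Q τ s (f s))) =
      GOp P (mulOp D (GOp Q f)) t := by
  obtain ⟨M, ω, hM, hb⟩ := id hPb
  obtain ⟨M', ω', hM', hb'⟩ := id hQb
  obtain ⟨K, hK⟩ := hD.exists_nnnorm_le
  set μ : Measure ℝ := volume.restrict (Ioc 0 t) with hμ
  have hμle : μ ≤ halfLine := Measure.restrict_mono_set _ fun x hx => hx.1.le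
  set S : Set (ℝ × ℝ) := {q | q.2 < q.1} with hS
  have hSm : MeasurableSet S := measurableSet_lt measurable_snd measurable_fst
  set h : ℝ × ℝ → X := fun q => P t q.1 (D q.1 (Q q.1 q.2 (f q.2))) with hh
  have hmem : ∀ᵐ q ∂(μ.prod μ), q ∈ Ioc 0 t ×ˢ Ioc 0 t := by
    rw [hμ, Measure.prod_restrict]
    exact ae_restrict_mem (measurableSet_Ioc.prod measurableSet_Ioc)
  have hmeas : AEStronglyMeasurable h ((μ.prod μ).restrict S) := by
    refine aestronglyMeasurable_clm_apply (D := fun q : ℝ × ℝ => P t q.1) (fun x => ?_)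
      (aestronglyMeasurable_clm_apply (D := fun q : ℝ × ℝ => D q.1) (fun x => ?_) ?_)
    · have hc : ContinuousOn (fun τ => P t τ x) (Ioc 0 t) :=
        (hP.continuousOn x).comp (f := fun τ => (t, τ)) (by fun_prop)
          fun τ hτ => ⟨hτ.1.le, hτ.2⟩
      exact ((hc.aestronglyMeasurable measurableSet_Ioc).comp_fst (ν := μ)).mono_measure
        Measure.restrict_le_self
    · exact ((hD.aestronglyMeasurable x).mono_measure hμle).comp_fst.mono_measure
        Measure.restrict_le_self
    · refine (hQ.aestronglyMeasurable_kernel hf.1).mono_measure ?_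
      rw [hμ, Measure.prod_restrict, Measure.restrict_restrict hSm, ← Measure.volume_eq_prod]
      exact Measure.restrict_mono_set _ fun q hq => ⟨hq.2.2.1, le_of_lt hq.1⟩
  have hint : Integrable (S.indicator h) (μ.prod μ) := by
    rw [integrable_indicator_iff hSm]
    have hfi : Integrable (fun q : ℝ × ℝ => f q.2) (μ.prod μ) :=
      Integrable.comp_snd (integrableOn_Ioc_of_memLp hp hf le_rfl t) μ
    refine ((hfi.norm.const_mul (M * Real.exp (|ω| * t) *
      (K * (M' * Real.exp (|ω'| * t))))).mono_measure Measure.restrict_le_self).mono' hmeas ?_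
    have hK' : ∀ᵐ q ∂(μ.prod μ), ‖D q.1‖ ≤ K :=
      Measure.quasiMeasurePreserving_fst.ae (ae_mono hμle hK)
    filter_upwards [ae_restrict_mem hSm, ae_restrict_of_ae hmem, ae_restrict_of_ae hK']
      with q hqS hq hqK
    have hlt : q.2 < q.1 := hqS
    have h1 := hb.norm_le hM hq.1.1.le hq.1.2 (T := t) (by linarith [hq.1.1])
    have h2 := hb'.norm_le hM' hq.2.1.le hlt.le (T := t) (by linarith [hq.2.1, hq.1.2])
    exact ((P t q.1).le_of_opNorm_le_of_le h1
      ((D q.1).le_of_opNorm_le_of_le hqK ((Q q.1 q.2).le_of_opNorm_le h2 _))).trans_eq (by ring)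
  have hswap := integral_integral_swap (μ := μ) (ν := μ)
    (f := fun τ s => S.indicator h (τ, s)) hint
  have hleft : ∫ s in (0 : ℝ)..t, ∫ τ in s..t, h (τ, s) =
      ∫ s, ∫ τ, S.indicator h (τ, s) ∂μ ∂μ := by
    rw [intervalIntegral.integral_of_le ht]
    refine setIntegral_congr_fun measurableSet_Ioc fun s hs => ?_
    have hind : (fun τ => S.indicator h (τ, s)) = (Ioi s).indicator fun τ => h (τ, s) := rfl
    simp only [hind]
    rw [hμ, setIntegral_indicator measurableSet_Ioi, intervalIntegral.integral_of_le hs.2]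
    congr 2
    ext τ
    exact ⟨fun hτ => ⟨⟨hs.1.trans hτ.1, hτ.2⟩, hτ.1⟩, fun hτ => ⟨hτ.2, hτ.1.2⟩⟩
  have hright : GOp P (mulOp D (GOp Q f)) t = ∫ τ, ∫ s, S.indicator h (τ, s) ∂μ ∂μ := by
    rw [GOp, intervalIntegral.integral_of_le ht]
    refine setIntegral_congr_fun measurableSet_Ioc fun τ hτ => ?_
    have hind : (fun s => S.indicator h (τ, s)) = (Iio τ).indicator fun s => h (τ, s) := rfl
    have hset : Ioc 0 t ∩ Iio τ = Ioo 0 τ := by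
      ext s
      exact ⟨fun hs => ⟨hs.1.1, hs.2⟩, fun hs => ⟨⟨hs.1, hs.2.le.trans hτ.2⟩, hs.2⟩⟩
    simp only [hind]
    rw [hμ, setIntegral_indicator measurableSet_Iio, hset, ← integral_Ioc_eq_integral_Ioo]
    have hi := hQ.integrableOn_kernel hQb hp hf τ
    simp only [mulOp, GOp, hh]
    rw [intervalIntegral.integral_of_le hτ.1.le]
    exact (((P t τ).comp (D τ)).integral_comp_comm hi).symm
  exact hleft.trans (hswap.symm.trans hright.symm)

/-- The variation-of-constants formula `W = V + ∫ P D Q` for evolution families integrates to the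
operator identity `𝔾_W = 𝔾_V + 𝔾_P 𝓓 𝔾_Q`. -/
theorem GOp_sub_GOp_eq [CompleteSpace X] {V W P Q : ℝ → ℝ → X →L[ℂ] X}
    (hV : IsEvolutionFamily V) (hVb : IsExpBounded V)
    (hW : IsEvolutionFamily W) (hWb : IsExpBounded W)
    (hP : IsEvolutionFamily P) (hPb : IsExpBounded P)
    (hQ : IsEvolutionFamily Q) (hQb : IsExpBounded Q)
    {D : ℝ → X →L[ℂ] X} (hD : IsLinftyStrong D)
    (hpert : ∀ t s, 0 ≤ s → s ≤ t → ∀ x : X,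
      W t s x = V t s x + ∫ τ in s..t, P t τ (D τ (Q τ s x)))
    {p : ℝ≥0∞} (hp : 1 ≤ p) {f : ℝ → X} (hf : MemLp f p halfLine) {t : ℝ} (ht : 0 ≤ t) :
    GOp W f t - GOp V f t = GOp P (mulOp D (GOp Q f)) t := by
  rw [← integral_perturbation_eq hP hPb hQ hQb hD hp hf ht, GOp, GOp,
    ← intervalIntegral.integral_sub
      ((intervalIntegrable_iff_integrableOn_Ioc_of_le ht).2 (hW.integrableOn_kernel hWb hp hf t))
      ((intervalIntegrable_iff_integrableOn_Ioc_of_le ht).2 (hV.integrableOn_kernel hVb hp hf t))]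
  refine intervalIntegral.integral_congr fun s hs => ?_
  rw [uIcc_of_le ht] at hs
  rw [hpert t s hs.1 hs.2, add_sub_cancel_left]

theorem IsExpStable.isExpBounded {V : ℝ → ℝ → X →L[ℂ] X} (h : IsExpStable V) : IsExpBounded V :=
  let ⟨M, ω, hM, _, hb⟩ := h
  ⟨M, ω, hM, hb⟩

/-! ### Datko's theorem: boundedness of `𝔾` implies exponential stability -/

/-- A uniformly bounded evolution family that contracts by a factor `1/2` over every time span `T`
is exponentially stable. -/
theorem isExpStable_of_contraction {V : ℝ → ℝ → X →L[ℂ] X} (hV : IsEvolutionFamily V)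
    {N T : ℝ} (hN : 1 ≤ N) (hT : 0 < T) (hb : ∀ t τ, 0 ≤ τ → τ ≤ t → ‖V t τ‖ ≤ N)
    (hc : ∀ τ, 0 ≤ τ → ‖V (τ + T) τ‖ ≤ 1 / 2) : IsExpStable V := by
  have hpow : ∀ (n : ℕ) (t τ : ℝ), 0 ≤ τ → τ + n * T ≤ t → ‖V t τ‖ ≤ N * (1 / 2) ^ n := by
    intro n
    induction n with
    | zero => intro t τ hτ h; simpa using hb t τ hτ (by simpa using h)
    | succ n ih =>
      intro t τ hτ h
      push_cast at h
      have hn : 0 ≤ (n : ℝ) * T := by positivity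
      rw [hV.comp t (τ + T) τ hτ (by linarith) (by linarith), pow_succ, ← mul_assoc]
      refine (ContinuousLinearMap.opNorm_comp_le _ _).trans ?_
      have h1 := ih t (τ + T) (by linarith) (by linarith)
      have h2 := hc τ hτ
      gcongr
  have hlog : 0 < Real.log 2 := Real.log_pos (by norm_num)
  refine ⟨2 * N, -(Real.log 2 / T), by linarith, neg_lt_zero.2 (by positivity), ?_⟩
  intro t τ hτ hτt
  have h0 : 0 ≤ (t - τ) / T := div_nonneg (sub_nonneg.2 hτt) hT.le
  set n := ⌊(t - τ) / T⌋₊ with hn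
  have hle : (n : ℝ) * T ≤ t - τ := (le_div_iff₀ hT).1 (Nat.floor_le h0)
  have hlt : (t - τ) / T < n + 1 := Nat.lt_floor_add_one _
  refine (hpow n t τ hτ (by linarith)).trans ?_
  have hexp : ((1 : ℝ) / 2) ^ n = Real.exp (-(Real.log 2 * n)) := by
    rw [one_div, inv_pow, Real.exp_neg, Real.exp_mul, Real.exp_log two_pos, Real.rpow_natCast]
  calc N * (1 / 2) ^ n = 2 * N * Real.exp (-(Real.log 2 * (n + 1))) := by
        rw [hexp, mul_add, mul_one, neg_add, Real.exp_add, Real.exp_neg (Real.log 2),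
          Real.exp_log two_pos]
        ring
    _ ≤ 2 * N * Real.exp (-(Real.log 2 / T) * (t - τ)) := by
        gcongr
        have : -(Real.log 2 / T) * (t - τ) = -(Real.log 2 * ((t - τ) / T)) := by ring
        rw [this]
        gcongr

/-- The test function `f = 1_{(s, s+1]} V(·, s) x` has `(𝔾 f)(t) = V(t, s) x` for `t ≥ s + 1`, so
the orbits of an evolution family with bounded `𝔾` are uniformly in `L^p`. -/
theorem exists_eLpNorm_orbit_le [CompleteSpace X] {p : ℝ≥0∞}
    {V : ℝ → ℝ → X →L[ℂ] X} (hV : IsEvolutionFamily V) (hVb : IsExpBounded V)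
    (hG : IsBoundedLp p (GOp V)) :
    ∃ K : ℝ≥0, ∀ s, 0 ≤ s → ∀ x : X,
      eLpNorm (fun t => V t s x) p (volume.restrict (Ici (s + 1))) ≤ K * ‖x‖ₑ := by
  obtain ⟨M, ω, hM, hb⟩ := hVb
  obtain ⟨K, hK⟩ := hG
  have hC0 : 0 ≤ M * Real.exp (|ω| * 1) := by positivity
  set c : ℝ≥0 := ⟨M * Real.exp (|ω| * 1), hC0⟩ with hc
  refine ⟨K * c, fun s hs x => ?_⟩
  set f : ℝ → X := (Ioc s (s + 1)).indicator fun t => V t s x with hf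
  have hsub : Ioc s (s + 1) ⊆ Ici 0 := fun t ht => hs.trans ht.1.le
  have hrestrict : halfLine.restrict (Ioc s (s + 1)) = volume.restrict (Ioc s (s + 1)) := by
    rw [halfLine, Measure.restrict_restrict measurableSet_Ioc, inter_eq_left.2 hsub]
  have hcont : ContinuousOn (fun t => V t s x) (Ioc s (s + 1)) :=
    (hV.continuousOn x).comp (f := fun t => (t, s)) (by fun_prop) fun t ht => ⟨hs, ht.1.le⟩
  have hbound : ∀ᵐ t ∂(volume.restrict (Ioc s (s + 1))), ‖V t s x‖ ≤ c * ‖x‖ := by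
    filter_upwards [ae_restrict_mem measurableSet_Ioc] with t ht
    exact (V t s).le_of_opNorm_le (hb.norm_le hM hs ht.1.le (by linarith [ht.2])) x
  have hfnorm : eLpNorm f p halfLine ≤ c * ‖x‖ₑ := by
    rw [hf, eLpNorm_indicator_eq_eLpNorm_restrict measurableSet_Ioc, hrestrict]
    refine (eLpNorm_le_of_ae_bound hbound).trans_eq ?_
    simp [ENNReal.ofReal_mul]
  have hfmem : MemLp f p halfLine := by
    refine ⟨?_, hfnorm.trans_lt (ENNReal.mul_lt_top ENNReal.coe_lt_top enorm_lt_top)⟩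
    rw [hf, aestronglyMeasurable_indicator_iff measurableSet_Ioc, hrestrict]
    exact hcont.aestronglyMeasurable measurableSet_Ioc
  have hGf : ∀ t ∈ Ici (s + 1), GOp V f t = V t s x := by
    intro t ht
    have ht' : s + 1 ≤ t := ht
    rw [GOp, intervalIntegral.integral_of_le (by linarith)]
    have heq : ∀ τ ∈ Ioc 0 t, V t τ (f τ) = (Ioc s (s + 1)).indicator (fun _ => V t s x) τ := by
      intro τ hτ
      by_cases h : τ ∈ Ioc s (s + 1)
      · rw [hf, indicator_of_mem h, indicator_of_mem h, hV.comp t τ s hs h.1.le hτ.2]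
        rfl
      · rw [hf, indicator_of_notMem h, indicator_of_notMem h, map_zero]
    have hsub' : Ioc s (s + 1) ⊆ Ioc 0 t := Ioc_subset_Ioc hs ht'
    rw [setIntegral_congr_fun measurableSet_Ioc heq, setIntegral_indicator measurableSet_Ioc,
      inter_eq_right.2 hsub']
    simp
  calc eLpNorm (fun t => V t s x) p (volume.restrict (Ici (s + 1)))
      = eLpNorm (GOp V f) p (volume.restrict (Ici (s + 1))) :=
        eLpNorm_congr_ae ((ae_restrict_mem measurableSet_Ici).mono fun t ht => (hGf t ht).symm)
    _ ≤ eLpNorm (GOp V f) p halfLine :=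
        eLpNorm_mono_measure _ (Measure.restrict_mono_set _ (Ici_subset_Ici.2 (by linarith)))
    _ ≤ K * (c * ‖x‖ₑ) := (hK f hfmem).2.trans (by gcongr)
    _ = (K * c : ℝ≥0) * ‖x‖ₑ := by rw [ENNReal.coe_mul, mul_assoc]

/-- If `‖V(t, s) x‖ ≤ c ‖V(τ, s) x‖` for `τ` in an interval `[a, t]`, an `L^p` bound on the orbit
controls `‖V(t, s) x‖ (t - a)^{1/p}`. -/
theorem norm_mul_rpow_le_of_eLpNorm_orbit_le {p : ℝ≥0∞} (hp : 1 ≤ p) (hp' : p ≠ ∞)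
    {V : ℝ → ℝ → X →L[ℂ] X} {K c : ℝ≥0} {s a t : ℝ} {x : X} (ha : s + 1 ≤ a) (hat : a ≤ t)
    (hK : eLpNorm (fun t => V t s x) p (volume.restrict (Ici (s + 1))) ≤ K * ‖x‖ₑ)
    (hc : ∀ τ ∈ Icc a t, ‖V t s x‖ ≤ c * ‖V τ s x‖) :
    ‖V t s x‖ * (t - a) ^ (1 / p.toReal) ≤ c * K * ‖x‖ := by
  have hp0 : p ≠ 0 := (one_pos.trans_le hp).ne'
  have h : eLpNorm (fun _ : ℝ => V t s x) p (volume.restrict (Icc a t)) ≤ c * (K * ‖x‖ₑ) := by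
    calc _ ≤ c • eLpNorm (fun τ => V τ s x) p (volume.restrict (Icc a t)) :=
          eLpNorm_le_nnreal_smul_eLpNorm_of_ae_le_mul
            ((ae_restrict_mem measurableSet_Icc).mono fun τ hτ => hc τ hτ) p
      _ ≤ c * (K * ‖x‖ₑ) := by
          rw [ENNReal.smul_def, smul_eq_mul]
          gcongr
          refine (eLpNorm_mono_measure _ (Measure.restrict_mono_set _ ?_)).trans hK
          exact fun τ hτ => ha.trans hτ.1
  rw [eLpNorm_const' _ hp0 hp', Measure.restrict_apply_univ, Real.volume_Icc,
    ENNReal.ofReal_rpow_of_nonneg (sub_nonneg.2 hat) (by positivity)] at h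
  have h' := ENNReal.toReal_mono (by finiteness) h
  rw [ENNReal.toReal_mul, ENNReal.toReal_ofReal
    (Real.rpow_nonneg (sub_nonneg.2 hat) _)] at h'
  simpa [mul_assoc] using h'

/-- Datko's argument. An `L^p` bound on the orbits yields first uniform boundedness, and then
`‖V(t, s)‖ = O((t - s)^{-1/p})`, so that `V` contracts over a sufficiently long time span. -/
theorem isExpStable_of_isBoundedLp_GOp [CompleteSpace X] {p : ℝ≥0∞} (hp : 1 ≤ p) (hp' : p ≠ ∞)
    {V : ℝ → ℝ → X →L[ℂ] X} (hV : IsEvolutionFamily V) (hVb : IsExpBounded V)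
    (hG : IsBoundedLp p (GOp V)) : IsExpStable V := by
  have hp0 : p ≠ 0 := (one_pos.trans_le hp).ne'
  have hr0 : 0 < p.toReal := ENNReal.toReal_pos hp0 hp'
  obtain ⟨K, hK⟩ := exists_eLpNorm_orbit_le hV hVb hG
  obtain ⟨M, ω, hM, hb⟩ := hVb
  set c : ℝ≥0 := ⟨M * Real.exp (|ω| * 2), by positivity⟩ with hc
  have hc1 : 1 ≤ (c : ℝ) := one_le_mul_of_one_le_of_one_le hM (Real.one_le_exp (by positivity))
  obtain ⟨N, hN, hNb⟩ : ∃ N : ℝ≥0, 1 ≤ (N : ℝ) ∧ ∀ t τ, 0 ≤ τ → τ ≤ t → ‖V t τ‖ ≤ N := by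
    have hcK : 0 ≤ (c : ℝ) * K := by positivity
    refine ⟨c * K + c, by push_cast; linarith, fun t s hs hst => ?_⟩
    push_cast
    rcases le_total t (s + 2) with h | h
    · refine (hb.norm_le hM hs hst (T := 2) (by linarith)).trans ?_
      exact le_add_of_nonneg_left hcK
    · refine le_trans ?_ (le_add_of_nonneg_right c.coe_nonneg)
      refine (V t s).opNorm_le_bound hcK fun x => ?_
      -- The orbit at time `t` is controlled by the orbit on the unit interval `[t - 1, t]`.
      have := norm_mul_rpow_le_of_eLpNorm_orbit_le hp hp' (a := t - 1) (c := c) (by linarith)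
        (by linarith) (hK s hs x) fun τ hτ => by
          rw [hV.comp t τ s hs (by linarith [hτ.1]) hτ.2]
          exact (V t τ).le_of_opNorm_le
            (hb.norm_le hM (by linarith [hτ.1]) hτ.2 (by linarith [hτ.1])) _
      simpa using this
  -- Over a time span `1 + L` the norm is at most `N K L^{-1/p} = N K / (2 N K + 1) ≤ 1/2`.
  set L : ℝ := (2 * (N * K) + 1) ^ p.toReal with hL
  have hNK : 0 ≤ (N : ℝ) * K := by positivity
  have hL0 : 0 ≤ L := by positivity
  refine isExpStable_of_contraction hV hN (T := 1 + L) (by linarith) hNb fun s hs => ?_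
  refine ContinuousLinearMap.opNorm_le_bound _ (by norm_num) fun x => ?_
  have h := norm_mul_rpow_le_of_eLpNorm_orbit_le hp hp' (a := s + 1) (t := s + (1 + L)) (c := N)
    le_rfl (by linarith) (hK s hs x) fun τ hτ => by
      rw [hV.comp _ τ s hs (by linarith [hτ.1]) hτ.2]
      exact (V _ τ).le_of_opNorm_le (hNb _ _ (by linarith [hτ.1]) hτ.2) _
  have hLr : (s + (1 + L) - (s + 1)) ^ (1 / p.toReal) = 2 * (N * K) + 1 := by
    rw [show s + (1 + L) - (s + 1) = L by ring, hL, one_div,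
      Real.rpow_rpow_inv (by positivity) hr0.ne']
  rw [hLr] at h
  refine le_of_mul_le_mul_right (h.trans ?_) (show 0 < 2 * ((N : ℝ) * K) + 1 by positivity)
  nlinarith [norm_nonneg x]

/-! ### Stabilizability and detectability -/

/-- With `𝔾_F` the operator of the stable closed-loop family, `𝔾 = 𝔾_F - (𝔾 𝓑) 𝓕 𝔾_F` and hence
`S 𝔾 = S 𝔾_F - (S 𝔾 𝓑) 𝓕 𝔾_F` for every multiplication operator `S`. -/
theorem IsStabilizable.isBoundedLp_mulOp_GOp [CompleteSpace X] {p : ℝ≥0∞} (hp : 1 ≤ p)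
    (hp' : p ≠ ∞) {𝒰 : ℝ → ℝ → X →L[ℂ] X} (hU : IsEvolutionFamily 𝒰) (hUb : IsExpBounded 𝒰)
    {B : ℝ → U →L[ℂ] X} (hB : IsLinftyStrong B) (hst : IsStabilizable 𝒰 B)
    {S : ℝ → X →L[ℂ] Y} (hS : IsLinftyStrong S) (hio : IsBoundedLp p (ioOp 𝒰 B S)) :
    IsBoundedLp p (fun f => mulOp S (GOp 𝒰 f)) := by
  obtain ⟨F, V, hF, hV, hVs, hpert⟩ := hst
  have hVG := isBoundedLp_GOp_of_isExpStable hp hp' hV hVs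
  refine IsBoundedLp.congr (((isBoundedLp_mulOp p hS).comp hVG).sub hp
    (hio.comp ((isBoundedLp_mulOp p hF).comp hVG))) fun f hf t ht => ?_
  have h : GOp V f t - GOp 𝒰 f t = GOp 𝒰 (mulOp B (mulOp F (GOp V f))) t :=
    GOp_sub_GOp_eq hU hUb hV hVs.isExpBounded hU hUb hV hVs.isExpBounded (hB.comp hF) hpert hp hf ht
  simp only [ioOp, Pi.sub_apply]
  rw [mulOp, mulOp, mulOp, ← h, map_sub, sub_sub_cancel]

/-- With `𝔾_K` the operator of the stable observer family, `𝔾 = 𝔾_K - 𝔾_K 𝓚 (𝓒 𝔾)`. -/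
theorem IsDetectable.isBoundedLp_GOp [CompleteSpace X] {p : ℝ≥0∞} (hp : 1 ≤ p)
    (hp' : p ≠ ∞) {𝒰 : ℝ → ℝ → X →L[ℂ] X} (hU : IsEvolutionFamily 𝒰) (hUb : IsExpBounded 𝒰)
    {C : ℝ → X →L[ℂ] Y} (hC : IsLinftyStrong C) (hdet : IsDetectable 𝒰 C)
    (hCG : IsBoundedLp p (fun f => mulOp C (GOp 𝒰 f))) : IsBoundedLp p (GOp 𝒰) := by
  obtain ⟨K, V, hK, hV, hVs, hpert⟩ := hdet
  have hVG := isBoundedLp_GOp_of_isExpStable hp hp' hV hVs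
  refine IsBoundedLp.congr (hVG.sub hp (hVG.comp ((isBoundedLp_mulOp p hK).comp hCG)))
    fun f hf t ht => ?_
  have h : GOp V f t - GOp 𝒰 f t = GOp V (mulOp K (mulOp C (GOp 𝒰 f))) t :=
    GOp_sub_GOp_eq hU hUb hV hVs.isExpBounded hV hVs.isExpBounded hU hUb (hK.comp hC) hpert hp hf ht
  rw [Pi.sub_apply, ← h, sub_sub_cancel]

/-- The zero feedback leaves the family unchanged. -/
theorem IsExpStable.isStabilizable {𝒰 : ℝ → ℝ → X →L[ℂ] X} (hU : IsEvolutionFamily 𝒰)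
    (hs : IsExpStable 𝒰) (B : ℝ → U →L[ℂ] X) : IsStabilizable 𝒰 B :=
  ⟨fun _ => 0, 𝒰, isLinftyStrong_zero, hU, hs, fun t s _ _ x => by simp⟩

theorem IsExpStable.isDetectable {𝒰 : ℝ → ℝ → X →L[ℂ] X} (hU : IsEvolutionFamily 𝒰)
    (hs : IsExpStable 𝒰) (C : ℝ → X →L[ℂ] Y) : IsDetectable 𝒰 C :=
  ⟨fun _ => 0, 𝒰, isLinftyStrong_zero, hU, hs, fun t s _ _ x => by simp⟩

end EvolutionSystem

end

theorem theorem4p3 {X U Y : Type*}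
    [NormedAddCommGroup X] [NormedSpace ℂ X] [CompleteSpace X]
    [NormedAddCommGroup U] [NormedSpace ℂ U] [CompleteSpace U]
    [NormedAddCommGroup Y] [NormedSpace ℂ Y] [CompleteSpace Y]
    (p : ℝ≥0∞) (hp : 1 ≤ p) (hp' : p ≠ ∞)
    (𝒰 : ℝ → ℝ → X →L[ℂ] X)
    (hU : EvolutionSystem.IsEvolutionFamily 𝒰) (hUb : EvolutionSystem.IsExpBounded 𝒰)
    (B : ℝ → U →L[ℂ] X) (hB : EvolutionSystem.IsLinftyStrong B)
    (C : ℝ → X →L[ℂ] Y) (hC : EvolutionSystem.IsLinftyStrong C) :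
    List.TFAE [
      EvolutionSystem.IsExpStable 𝒰,
      EvolutionSystem.IsBoundedLp p (EvolutionSystem.GOp 𝒰),
      EvolutionSystem.IsStabilizable 𝒰 B ∧
        EvolutionSystem.IsBoundedLp p
          (fun u => EvolutionSystem.GOp 𝒰 (EvolutionSystem.mulOp B u)),
      EvolutionSystem.IsDetectable 𝒰 C ∧
        EvolutionSystem.IsBoundedLp p
          (fun f => EvolutionSystem.mulOp C (EvolutionSystem.GOp 𝒰 f)),
      EvolutionSystem.IsStabilizable 𝒰 B ∧ EvolutionSystem.IsDetectable 𝒰 C ∧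
        EvolutionSystem.IsBoundedLp p (EvolutionSystem.ioOp 𝒰 B C)] := by
  have hGB : EvolutionSystem.IsBoundedLp p (EvolutionSystem.GOp 𝒰) →
      EvolutionSystem.IsBoundedLp p
        (fun u => EvolutionSystem.GOp 𝒰 (EvolutionSystem.mulOp B u)) :=
    fun hG => hG.comp (EvolutionSystem.isBoundedLp_mulOp p hB)
  have hG_of := EvolutionSystem.isBoundedLp_GOp_of_isExpStable hp hp' hU
  tfae_have 1 → 2 := hG_of
  tfae_have 2 → 1 := EvolutionSystem.isExpStable_of_isBoundedLp_GOp hp hp' hU hUb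
  tfae_have 1 → 3 := fun h => ⟨h.isStabilizable hU B, hGB (hG_of h)⟩
  tfae_have 1 → 4 := fun h =>
    ⟨h.isDetectable hU C, (EvolutionSystem.isBoundedLp_mulOp p hC).comp (hG_of h)⟩
  tfae_have 1 → 5 := fun h => ⟨h.isStabilizable hU B, h.isDetectable hU C,
    (EvolutionSystem.isBoundedLp_mulOp p hC).comp (hGB (hG_of h))⟩
  tfae_have 3 → 2 := fun h =>
    h.1.isBoundedLp_mulOp_GOp hp hp' hU hUb hB EvolutionSystem.isLinftyStrong_id h.2
  tfae_have 4 → 2 := fun h => h.1.isBoundedLp_GOp hp hp' hU hUb hC h.2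
  tfae_have 5 → 4 := fun h => ⟨h.2.1, h.1.isBoundedLp_mulOp_GOp hp hp' hU hUb hB hC h.2.2⟩
  tfae_finish
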